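/- **Definitions.** A Büchi automaton over a finite alphabet $\Sigma$ has a finite set of states, an initial state, a transition table $\Delta\subseteq S\times\Sigma\times S$ and a set of accepting states; it accepts an infinite string $\alpha\in\Sigma^\omega$ if some run on $\alpha$ visits some accepting state infinitely often. A set of infinite strings is Büchi recognizable if it is the set of strings accepted by some Büchi automaton. A $k$-ary relation on $\Sigma^\omega$ is Büchi recognizable if the set of convolutions of its tuples (as infinite strings over $\Sigma^k$) is. A relational structure with nonempty domain $A\subseteq\Sigma^\omega$ is Büchi automatic if its domain and its basic relations are Büchi recognizable, and it is Borel if they are Borel; a structure is Büchi (Borel) presentable if it is isomorphic to a Büchi automatic (Borel) structure over some finite alphabet. The quotient $\mathcal A/E$ of a relational structure by an equivalence relation $E$ on its domain has the $E$-classes as elements, and a basic relation holds of a tuple of classes if it holds of some tuple of representatives. For $X,Y\subseteq\mathbb N$, $X=^*Y$ means that $X\,\triangle\,Y$ is finite, and $[X]\le[Y]$ in $\mathcal P(\mathbb N)/{=^*}$ means that $X\setminus Y$ is finite. **Theorem** (Hjorth, Khoussainov, Montalbán, Nies; 2008). The class of Büchi automatic structures is not closed, even up to isomorphism, under quotients by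 Büchi recognizable equivalence relations. More precisely: 1. There are a Büchi automatic structure $\mathcal A=(A;\le,U,R)$ and a Büchi recognizable equivalence relation $E$ on $A$ such that - $\mathcal A$ is isomorphic to the disjoint union of two copies $\mathcal P(\mathbb N)\times\{0\}$ and $\mathcal P(\mathbb N)\times\{1\}$ of $(\mathcal P(\mathbb N);\subseteq)$, with the unary relation $U$ that holds exactly on the first copy and the binary relation $R=\{((X,0),(X,1)) : X\subseteq\mathbb N\}$, by an isomorphism that carries $E$ to the relation which is equality on the first copy, $=^*$ on the second copy, and relates no element of one copy to an element of the other; - $\mathcal A/E$ is isomorphic to the disjoint union of $(\mathcal P(\mathbb N);\subseteq)$ and $(\mathcal P(\mathbb N)/{=^*};\le)$, with $U$ holding exactly on $\mathcal P(\mathbb N)$ and $R$ being the graph of the canonical projection $\mathcal P(\mathbb N)\to\mathcal P(\mathbb N)/{=^*}$; - $\mathcal A/E$ is not Büchi presentable, and it is not even Borel presentable. 2. The equivalence relation can also be taken to be a congruence: there are a Büchi automatic structure $\mathcal A=(A;\le,U,R)$ and a Büchi recognizable equivalence relation $E$ on $A$ under which every basic relation of $\mathcal A$ is invariant, such that $\mathcal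 A/E$ is isomorphic to the same disjoint union as in 1 and is neither Büchi presentable nor Borel presentable. -/

import Mathlib

open FirstOrder Filter

/-! ### Büchi automata -/

/-- A Büchi automaton over the alphabet `α` with set of states `σ`: an initial state, a transition
table and a set of accepting states. Finiteness of `α` and `σ` is required where automata are used. -/
structure BuchiAutomaton (α σ : Type) where
  init : σ
  trans : Set (σ × α × σ)
  accept : Set σ

namespace BuchiAutomaton

variable {α σ : Type}

/-- `q` is a run of `M` on the infinite string `w`. -/
def IsRun (M : BuchiAutomaton α σ) (w : ℕ → α) (q : ℕ → σ) : Prop :=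
  q 0 = M.init ∧ ∀ i, (q i, w i, q (i + 1)) ∈ M.trans

/-- `M` accepts `w` if on some run of `M` on `w` some accepting state appears infinitely often. -/
def Accepts (M : BuchiAutomaton α σ) (w : ℕ → α) : Prop :=
  ∃ q, M.IsRun w q ∧ ∃ s ∈ M.accept, ∃ᶠ i in atTop, q i = s

/-- The set of infinite strings that `M` accepts. -/
def acceptedSet (M : BuchiAutomaton α σ) : Set (ℕ → α) := {w | M.Accepts w}

end BuchiAutomaton

/-- A set of infinite strings is Büchi recognizable if it is the language of a Büchi automaton with
finitely many states. -/
def IsBuchiRecognizable {α : Type} (W : Set (ℕ → α)) : Prop :=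
  ∃ (σ : Type) (_ : Finite σ) (M : BuchiAutomaton α σ), M.acceptedSet = W

/-- The convolution of a `k`-tuple of infinite strings over `α`, an infinite string over `α ^ k`. -/
def convolution {α : Type} {k : ℕ} (x : Fin k → ℕ → α) : ℕ → (Fin k → α) := fun i j => x j i

/-- A `k`-ary relation on infinite strings is Büchi recognizable if the set of the convolutions of
its tuples is. -/
def IsBuchiRecognizableRel {α : Type} {k : ℕ} (R : Set (Fin k → ℕ → α)) : Prop :=
  IsBuchiRecognizable (convolution '' R)

/-! ### Structures on sets of infinite strings -/

/-- The interpretation of a relation symbol in a structure with domain `D ⊆ X`, as a set of tuples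
of elements of `X`. -/
def relSet (L : Language) {X : Type} (D : Set X) [L.Structure D] {n : ℕ} (r : L.Relations n) :
    Set (Fin n → X) :=
  (fun (y : Fin n → D) i => (y i : X)) '' {y | Language.Structure.RelMap r y}

/-- A binary relation on `D ⊆ X`, as a set of pairs of elements of `X`. -/
def pairSet {X : Type} (D : Set X) (E : D → D → Prop) : Set (Fin 2 → X) :=
  {x | ∃ a b : D, E a b ∧ x = ![(a : X), (b : X)]}

/-- A structure (with nonempty domain, in a relational language) whose elements are infinite strings
is Büchi automatic if its domain and its basic relations are Büchi recognizable. -/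
structure IsBuchiAutomatic (L : Language) [L.IsRelational] {α : Type} (D : Set (ℕ → α))
    [L.Structure D] : Prop where
  nonempty : D.Nonempty
  domain : IsBuchiRecognizable D
  relations : ∀ {n : ℕ} (r : L.Relations n), IsBuchiRecognizableRel (relSet L D r)

/-- A structure is Büchi automata presentable if it is isomorphic to a Büchi automatic structure
over some finite alphabet. -/
def IsBuchiPresentable (L : Language) [L.IsRelational] (M : Type) [L.Structure M] : Prop :=
  ∃ (α : Type) (_ : Finite α) (D : Set (ℕ → α)) (_ : L.Structure D),
    IsBuchiAutomatic L D ∧ Nonempty (M ≃[L] D)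

/-- A set of `k`-tuples of infinite strings over `α` is Borel for the product topology, where `α` is
discrete. -/
def IsBorelStringRel {α : Type} {k : ℕ} (R : Set (Fin k → ℕ → α)) : Prop :=
  letI : TopologicalSpace α := ⊥
  @MeasurableSet (Fin k → ℕ → α) (borel (Fin k → ℕ → α)) R

/-- A set of infinite strings over `α` is Borel for the product topology, where `α` is discrete. -/
def IsBorelStringSet {α : Type} (W : Set (ℕ → α)) : Prop :=
  letI : TopologicalSpace α := ⊥
  @MeasurableSet (ℕ → α) (borel (ℕ → α)) W

/-- A structure (with nonempty domain, in a relational language) whose elements are infinite strings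
is Borel if its domain and its basic relations are Borel. -/
structure IsBorelStructure (L : Language) [L.IsRelational] {α : Type} (D : Set (ℕ → α))
    [L.Structure D] : Prop where
  nonempty : D.Nonempty
  domain : IsBorelStringSet D
  relations : ∀ {n : ℕ} (r : L.Relations n), IsBorelStringRel (relSet L D r)

/-- A structure is Borel presentable if it is isomorphic to a Borel structure whose elements are
infinite strings over some finite alphabet. -/
def IsBorelPresentable (L : Language) [L.IsRelational] (M : Type) [L.Structure M] : Prop :=
  ∃ (α : Type) (_ : Finite α) (D : Set (ℕ → α)) (_ : L.Structure D),
    IsBorelStructure L D ∧ Nonempty (M ≃[L] D)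

/-! ### Quotient structures -/

/-- The domain of the quotient of the `L`-structure `M` by the equivalence relation `E`. -/
def QuotientStructure (L : Language) {M : Type} [L.Structure M] (E : Setoid M) : Type := Quotient E

/-- A basic relation holds of a tuple of classes if it holds of some tuple of representatives. -/
instance quotientInst (L : Language) [L.IsRelational] {M : Type} [L.Structure M] (E : Setoid M) :
    L.Structure (QuotientStructure L E) where
  funMap f _ := isEmptyElim f
  RelMap r x := ∃ y, (∀ i, (Quotient.mk E (y i) : QuotientStructure L E) = x i) ∧
    Language.Structure.RelMap r y

/-- `E` is a congruence: every basic relation is invariant under `E`. -/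
def IsCongruence (L : Language) {M : Type} [L.Structure M] (E : Setoid M) : Prop :=
  ∀ {n : ℕ} (r : L.Relations n) (x y : Fin n → M), (∀ i, E (x i) (y i)) →
    (Language.Structure.RelMap r x ↔ Language.Structure.RelMap r y)

/-! ### Power sets modulo finite sets -/

/-- `X =^* Y`: the sets `X` and `Y` agree except at finitely many points. -/
def eqStar : Setoid (Set ℕ) where
  r X Y := (symmDiff X Y).Finite
  iseqv :=
    { refl := fun X => by simp
      symm := fun {X Y} h => by rwa [symmDiff_comm]
      trans := fun {X Y Z} h h' => (h.union h').subset (symmDiff_triangle X Y Z) }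

/-- The order that inclusion induces on the classes of `=^*`: `[X] ≤ [Y]` if `X \ Y` is finite. -/
def leStar : Quotient eqStar → Quotient eqStar → Prop :=
  Quotient.lift₂ (fun X Y : Set ℕ => (X \ Y).Finite) (by
    have key : ∀ X Y X' Y' : Set ℕ, (symmDiff X X').Finite → (symmDiff Y Y').Finite →
        (X \ Y).Finite → (X' \ Y').Finite := by
      intro X Y X' Y' hX hY h
      refine ((hX.union hY).union h).subset ?_
      intro n hn
      simp only [Set.mem_union, Set.mem_symmDiff, Set.mem_sdiff] at hn ⊢
      tauto
    intro X Y X' Y' hX hY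
    exact propext ⟨key X Y X' Y' hX hY,
      key X' Y' X Y (eqStar.symm hX) (eqStar.symm hY)⟩)

/-! ### The witness -/

/-- The relation symbols `≤` (binary), `U` (unary) and `R` (binary). -/
inductive WitnessRel : ℕ → Type
  | le : WitnessRel 2
  | U : WitnessRel 1
  | R : WitnessRel 2

/-- The relational language with the symbols `≤`, `U` and `R`. -/
def witnessLang : Language := ⟨fun _ => Empty, WitnessRel⟩

instance witnessLangIsRelational : witnessLang.IsRelational := fun _ => inferInstanceAs (IsEmpty Empty)

/-- The disjoint union of two copies of the power set of the natural numbers. -/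
def TwoCopies : Type := Set ℕ ⊕ Set ℕ

/-- Each copy is ordered by inclusion, `U` is the first copy, and `R` is the bijection of the first
copy onto the second one that acts as the identity of the power set. -/
instance twoCopiesInst : witnessLang.Structure TwoCopies where
  funMap f _ := Empty.elim f
  RelMap {n} r := match n, r with
    | _, WitnessRel.le => fun x => Sum.LiftRel (· ⊆ ·) (· ⊆ ·) (x 0) (x 1)
    | _, WitnessRel.U => fun x => ∃ X : Set ℕ, x 0 = Sum.inl X
    | _, WitnessRel.R => fun x => ∃ X : Set ℕ, x 0 = Sum.inl X ∧ x 1 = Sum.inr X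

/-- Equality on the first copy and `=^*` on the second one. -/
def twoCopiesRel : TwoCopies → TwoCopies → Prop := Sum.LiftRel (· = ·) eqStar

/-- The disjoint union of the power set of the natural numbers and its quotient by `=^*`. -/
def PowersetAndQuotient : Type := Set ℕ ⊕ Quotient eqStar

/-- The summands carry inclusion and the induced order, `U` is the first summand, and `R` is the
canonical projection of the first summand onto the second one. -/
instance powersetAndQuotientInst : witnessLang.Structure PowersetAndQuotient where
  funMap f _ := Empty.elim f
  RelMap {n} r := match n, r with
    | _, WitnessRel.le => fun x => Sum.LiftRel (· ⊆ ·) leStar (x 0) (x 1)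
    | _, WitnessRel.U => fun x => ∃ X : Set ℕ, x 0 = Sum.inl X
    | _, WitnessRel.R => fun x =>
        ∃ X : Set ℕ, x 0 = Sum.inl X ∧ x 1 = Sum.inr (Quotient.mk eqStar X)

/-!
Büchi recognizable relations and Borel relations are both analytic, so it suffices to show that the
disjoint union of `𝒫(ℕ)` and `𝒫(ℕ)/=*` has no presentation with analytic relations. In such a
presentation, the element that represents a set `A` is determined by its order relations with the
elements that represent the singletons and their complements. Together with the projection `R`, this
makes the map from the characteristic sequence of `A` to the element that represents `[A]` a map
with analytic graph, and such a map is Borel by Suslin's theorem. But no Borel map on the Cantor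
space has the classes of `=*` as its fibres: the finitely supported sequences form a countable dense
subgroup of a compact group, so an invariant Borel map is almost everywhere constant for Haar
measure, while the classes of `=*` are countable and hence null.
-/

section

open MeasureTheory hiding convolution
open Topology

/-! ### Maps invariant under a countable dense subgroup -/

section Haar

variable {G Y : Type*} [AddGroup G] [TopologicalSpace G] [IsTopologicalAddGroup G] [CompactSpace G]

theorem nhdsNE_zero_neBot_of_compactSpace [Infinite G] : (𝓝[≠] (0 : G)).NeBot := by
  refine ⟨fun h => ?_⟩
  have := discreteTopology_of_isOpen_singleton_zero ((isOpen_singleton_iff_punctured_nhds _).2 h)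
  exact not_finite_iff_infinite.2 ‹_› (finite_of_compact_of_discrete (X := G))

variable [SecondCountableTopology G] [MeasurableSpace G] [BorelSpace G] [MeasurableSpace Y]
  [MeasurableSpace.CountablySeparated Y]

theorem exists_ae_eq_const_of_dense [Nonempty Y] {H : Set G} (hH : Dense H) {f : G → Y}
    (hf : Measurable f) (hinv : ∀ h ∈ H, ∀ x, f (h + x) = f x) (μ : Measure G)
    [μ.IsAddHaarMeasure] : ∃ y, ∀ᵐ x ∂μ, f x = y := by
  refine exists_eventuallyEq_const_of_forall_separating MeasurableSet fun U hU => ?_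
  have : EventuallyConst (f ⁻¹' U) (ae μ) := by
    refine aeconst_of_dense_setOfPred_preimage_vadd_ae (M := G) (hf hU).nullMeasurableSet
      (hH.mono fun h hh => ?_)
    change (h + ·) ⁻¹' (f ⁻¹' U) =ᵐ[μ] f ⁻¹' U
    have : (h + ·) ⁻¹' (f ⁻¹' U) = f ⁻¹' U := by
      ext x
      rw [Set.mem_preimage, Set.mem_preimage, Set.mem_preimage, hinv h hh]
    exact EventuallyEq.of_eq this
  exact eventuallyConst_pred.1 this

theorem not_forall_eq_iff_sub_mem [T1Space G] [Infinite G] {H : AddSubgroup G}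
    (hH : Dense (H : Set G)) (hc : (H : Set G).Countable) {f : G → Y} (hf : Measurable f) :
    ¬ ∀ x y, f x = f y ↔ x - y ∈ H := by
  intro hsub
  have : Nonempty Y := ⟨f 0⟩
  have : (𝓝[≠] (0 : G)).NeBot := nhdsNE_zero_neBot_of_compactSpace
  let μ : Measure G := Measure.addHaar
  obtain ⟨y, hy⟩ := exists_ae_eq_const_of_dense hH hf
    (fun h hh x => (hsub _ _).2 (by rwa [add_sub_cancel_right])) μ
  obtain ⟨x₀, hx₀⟩ := hy.exists
  have hcoset : {x | x - x₀ ∈ H}.Countable := hc.preimage sub_left_injective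
  obtain ⟨x, hx, hx'⟩ := (hy.and (measure_eq_zero_iff_ae_notMem.1 (hcoset.measure_zero μ))).exists
  exact hx' ((hsub x x₀).1 (hx.trans hx₀.symm))

end Haar

theorem dense_setOf_finite_support {ι M : Type*} [Zero M] [TopologicalSpace M] :
    Dense {x : ι → M | (Function.support x).Finite} := by
  classical
  intro x
  refine mem_closure_of_tendsto (f := fun s : Finset ι => (s : Set ι).indicator x) (b := atTop)
    (tendsto_pi_nhds.2 fun i => tendsto_const_nhds.congr' ?_)
    (.of_forall fun s => s.finite_toSet.subset Set.support_indicator_subset)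
  filter_upwards [eventually_ge_atTop {i}] with s hs
  exact (Set.indicator_of_mem (hs (Finset.mem_singleton_self i)) x).symm

theorem countable_setOf_finite_support {ι M : Type*} [Countable ι] [Countable M] [Zero M] :
    {x : ι → M | (Function.support x).Finite}.Countable :=
  (Set.countable_range ((⇑) : (ι →₀ M) → ι → M)).mono fun x hx =>
    Set.mem_range.2 ⟨Finsupp.ofSupportFinite x hx, rfl⟩

theorem not_forall_eq_iff_eventuallyEq_cofinite {ι Y : Type*} [Countable ι] [Infinite ι]
    [MeasurableSpace Y] [MeasurableSpace.CountablySeparated Y] {f : (ι → Bool) → Y}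
    (hf : Measurable f) : ¬ ∀ x y, f x = f y ↔ x =ᶠ[cofinite] y := by
  let H : AddSubgroup (ι → Bool) :=
    { carrier := {x | (Function.support x).Finite}
      zero_mem' := by simp
      add_mem' := fun hx hy => (hx.union hy).subset (Function.support_add _ _)
      neg_mem' := fun {x} hx => by simpa only [Set.mem_ofPred_eq, Function.support_neg] using hx }
  have hmem : ∀ x y, x - y ∈ H ↔ x =ᶠ[cofinite] y := fun x y => by
    change {n | (x - y) n ≠ 0}.Finite ↔ {n | ¬ x n = y n}.Finite
    simp only [Pi.sub_apply, sub_ne_zero, ne_eq]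
  simpa only [hmem] using not_forall_eq_iff_sub_mem (H := H) dense_setOf_finite_support
    countable_setOf_finite_support hf

/-! ### Analytic sets and analytic presentations -/

theorem analyticSet_inter {X : Type*} [TopologicalSpace X] [T2Space X] {s t : Set X}
    (hs : AnalyticSet s) (ht : AnalyticSet t) : AnalyticSet (s ∩ t) := by
  rw [Set.inter_eq_iInter]
  exact .iInter (Bool.forall_bool.2 ⟨ht, hs⟩)

theorem analyticSet_union {X : Type*} [TopologicalSpace X] {s t : Set X}
    (hs : AnalyticSet s) (ht : AnalyticSet t) : AnalyticSet (s ∪ t) := by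
  rw [Set.union_eq_iUnion]
  exact .iUnion (Bool.forall_bool.2 ⟨ht, hs⟩)

theorem measurable_of_analyticSet_graph {X Y : Type*} [TopologicalSpace X] [PolishSpace X]
    [MeasurableSpace X] [BorelSpace X] [TopologicalSpace Y] [PolishSpace Y] [MeasurableSpace Y]
    [BorelSpace Y] {f : X → Y} (hf : AnalyticSet {p : X × Y | f p.1 = p.2}) : Measurable f := by
  have hpre : ∀ B, MeasurableSet B → AnalyticSet (f ⁻¹' B) := fun B hB => by
    have : f ⁻¹' B = Prod.fst '' ({p : X × Y | f p.1 = p.2} ∩ Prod.snd ⁻¹' B) := by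
      ext x
      simp
    rw [this]
    exact (analyticSet_inter hf (hB.analyticSet.preimage continuous_snd)).image_of_continuous
      continuous_fst
  exact fun B hB => (hpre B hB).measurableSet_of_compl (hpre Bᶜ hB.compl)

theorem analyticSet_acceptedSet {α σ : Type} [TopologicalSpace α] [DiscreteTopology α]
    [Countable α] [Countable σ] (M : BuchiAutomaton α σ) : AnalyticSet M.acceptedSet := by
  let : TopologicalSpace σ := ⊥
  have : DiscreteTopology σ := ⟨rfl⟩
  have : PolishSpace α := inferInstance
  have : PolishSpace σ := inferInstance
  let : MeasurableSpace α := ⊤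
  let : MeasurableSpace σ := ⊤
  have : BorelSpace α := ⟨borel_eq_top_of_discrete.symm⟩
  have : BorelSpace σ := ⟨borel_eq_top_of_discrete.symm⟩
  have hfst : M.acceptedSet = Prod.fst '' {p : (ℕ → α) × (ℕ → σ) | M.IsRun p.1 p.2 ∧
      ∃ s ∈ M.accept, ∃ᶠ i in atTop, p.2 i = s} := by
    ext w
    simp [BuchiAutomaton.acceptedSet, BuchiAutomaton.Accepts]
  rw [hfst]
  refine AnalyticSet.image_of_continuous ?_ continuous_fst
  refine MeasurableSet.analyticSet (measurableSet_setOfPred.2 ?_)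
  have htrans : ∀ i, Measurable fun p : (ℕ → α) × (ℕ → σ) =>
      (p.2 i, p.1 i, p.2 (i + 1)) ∈ M.trans := fun i =>
    measurableSet_setOfPred.1 (MeasurableSet.of_discrete.preimage (t := M.trans) (by fun_prop))
  have hstate : ∀ i s, Measurable fun p : (ℕ → α) × (ℕ → σ) => p.2 i = s := fun i s =>
    measurableSet_setOfPred.1 (MeasurableSet.of_discrete.preimage (t := {s}) (by fun_prop))
  simp only [BuchiAutomaton.IsRun, frequently_atTop]
  exact ((hstate 0 M.init).and (.forall htrans)).and <| .exists fun s => measurable_const.and <|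
    .forall fun N => .exists fun n => measurable_const.and (hstate n s)

theorem convolution_injective {α : Type} {k : ℕ} :
    Function.Injective (convolution : (Fin k → ℕ → α) → ℕ → Fin k → α) :=
  fun _ _ h => funext fun j => funext fun i => congrFun (congrFun h i) j

theorem IsBuchiRecognizable.analyticSet {α : Type} [TopologicalSpace α] [DiscreteTopology α]
    [Countable α] {W : Set (ℕ → α)} (hW : IsBuchiRecognizable W) : AnalyticSet W := by
  obtain ⟨σ, _, M, rfl⟩ := hW
  exact analyticSet_acceptedSet M

theorem IsBuchiRecognizableRel.analyticSet {α : Type} [TopologicalSpace α] [DiscreteTopology α]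
    [Countable α] {k : ℕ} {R : Set (Fin k → ℕ → α)} (hR : IsBuchiRecognizableRel R) :
    AnalyticSet R := by
  have : PolishSpace α := inferInstance
  rw [← convolution_injective.preimage_image R]
  refine (IsBuchiRecognizable.analyticSet hR).preimage ?_
  exact continuous_pi fun i => continuous_pi fun j => by unfold convolution; fun_prop

theorem IsBorelStringRel.analyticSet {α : Type} [TopologicalSpace α] [DiscreteTopology α]
    [Countable α] {k : ℕ} {R : Set (Fin k → ℕ → α)} (hR : IsBorelStringRel R) :
    AnalyticSet R := by
  have : PolishSpace α := inferInstance
  let : MeasurableSpace (Fin k → ℕ → α) := borel _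
  have : BorelSpace (Fin k → ℕ → α) := ⟨rfl⟩
  refine MeasurableSet.analyticSet ?_
  obtain rfl : ‹TopologicalSpace α› = ⊥ := DiscreteTopology.eq_bot
  exact hR

theorem IsBorelStringSet.analyticSet {α : Type} [TopologicalSpace α] [DiscreteTopology α]
    [Countable α] {W : Set (ℕ → α)} (hW : IsBorelStringSet W) : AnalyticSet W := by
  have : PolishSpace α := inferInstance
  let : MeasurableSpace (ℕ → α) := borel _
  have : BorelSpace (ℕ → α) := ⟨rfl⟩
  refine MeasurableSet.analyticSet ?_
  obtain rfl : ‹TopologicalSpace α› = ⊥ := DiscreteTopology.eq_bot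
  exact hW

/-- A structure in a relational language is analytically presentable if it is isomorphic to one
whose domain and basic relations are analytic subsets of a Polish space and its finite powers. This
covers both Büchi and Borel presentable structures. -/
def IsAnalyticPresentable (L : Language) [L.IsRelational] (M : Type) [L.Structure M] : Prop :=
  ∃ (X : Type) (_ : TopologicalSpace X) (_ : PolishSpace X) (D : Set X) (_ : L.Structure D),
    AnalyticSet D ∧ (∀ {n : ℕ} (r : L.Relations n), AnalyticSet (relSet L D r)) ∧
      Nonempty (M ≃[L] D)
open MeasureTheory (AnalyticSet Measure)

theorem IsBuchiPresentable.isAnalyticPresentable {L : Language} [L.IsRelational] {M : Type}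
    [L.Structure M] (h : IsBuchiPresentable L M) : IsAnalyticPresentable L M := by
  obtain ⟨α, _, D, _, hD, e⟩ := h
  let : TopologicalSpace α := ⊥
  have : DiscreteTopology α := ⟨rfl⟩
  have : PolishSpace α := inferInstance
  exact ⟨_, _, inferInstance, D, _, hD.domain.analyticSet, fun r => (hD.relations r).analyticSet, e⟩

theorem IsBorelPresentable.isAnalyticPresentable {L : Language} [L.IsRelational] {M : Type}
    [L.Structure M] (h : IsBorelPresentable L M) : IsAnalyticPresentable L M := by
  obtain ⟨α, _, D, _, hD, e⟩ := h
  let : TopologicalSpace α := ⊥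
  have : DiscreteTopology α := ⟨rfl⟩
  have : PolishSpace α := inferInstance
  exact ⟨_, _, inferInstance, D, _, hD.domain.analyticSet, fun r => (hD.relations r).analyticSet, e⟩

theorem IsAnalyticPresentable.congr {L : Language} [L.IsRelational] {M N : Type}
    [L.Structure M] [L.Structure N] (e : M ≃[L] N) (h : IsAnalyticPresentable L M) :
    IsAnalyticPresentable L N := by
  obtain ⟨X, _, _, D, _, hD, hrel, ⟨φ⟩⟩ := h
  exact ⟨X, _, ‹_›, D, _, hD, hrel, ⟨φ.comp e.symm⟩⟩

/-! ### The canonical projection modulo `=^*` -/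

theorem setOf_eq_true_eq_iff {ι : Type*} {x : ι → Bool} {A : Set ι} : {n | x n = true} = A ↔
    ∀ n, x n = true ∧ {n} ⊆ A ∨ x n = false ∧ A ⊆ {n}ᶜ := by
  rw [Set.ext_iff]
  refine forall_congr' fun n => ?_
  rw [Set.singleton_subset_iff, Set.subset_compl_singleton_iff]
  cases hx : x n <;> simp [hx]

theorem measurable_of_analyticSet_subset {ι X : Type*} [Countable ι] [Nonempty ι]
    [TopologicalSpace X] [PolishSpace X] [MeasurableSpace X] [BorelSpace X]
    {LE R : Set (Fin 2 → X)} (hLE : AnalyticSet LE) (hR : AnalyticSet R) {c d : Set ι → X}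
    (hc : ∀ A B, ![c A, c B] ∈ LE ↔ A ⊆ B) (hcd : R = Set.range fun A => ![c A, d A]) :
    Measurable fun x : ι → Bool => d {n | x n = true} := by
  have : PolishSpace Bool := inferInstance
  let S : Set ((ι → Bool) × (Fin 2 → X)) := ⋂ n,
    ({q | q.1 n = true} ∩ (fun q => ![c {n}, q.2 0]) ⁻¹' LE ∪
      {q | q.1 n = false} ∩ (fun q => ![q.2 0, c {n}ᶜ]) ⁻¹' LE)
  have hS : AnalyticSet S := by
    have hbit (n : ι) (b : Bool) : AnalyticSet {q : (ι → Bool) × (Fin 2 → X) | q.1 n = b} :=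
      (isClosed_eq (by fun_prop) continuous_const).analyticSet
    refine .iInter fun n => analyticSet_union ?_ ?_
    · exact analyticSet_inter (hbit n true) (hLE.preimage (by fun_prop))
    · exact analyticSet_inter (hbit n false) (hLE.preimage (by fun_prop))
  have mem_S (x : ι → Bool) (A : Set ι) : (x, ![c A, d A]) ∈ S ↔ {n | x n = true} = A := by
    rw [setOf_eq_true_eq_iff, Set.mem_iInter]
    exact forall_congr' fun n => or_congr (and_congr_right' (hc _ _)) (and_congr_right' (hc _ _))
  have hgraph : {p : (ι → Bool) × X | d {n | p.1 n = true} = p.2} =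
      (fun q : (ι → Bool) × (Fin 2 → X) => (q.1, q.2 1)) '' (Prod.snd ⁻¹' R ∩ S) := by
    ext ⟨x, y⟩
    constructor
    · intro hxy
      exact ⟨(x, ![c _, d _]), ⟨hcd ▸ Set.mem_range_self _, (mem_S x _).2 rfl⟩,
        Prod.ext rfl hxy⟩
    · rintro ⟨⟨x, v⟩, ⟨hv, hx⟩, hxy⟩
      obtain ⟨A, rfl⟩ := hcd ▸ hv
      obtain rfl := (mem_S x A).1 hx
      cases hxy
      rfl
  refine measurable_of_analyticSet_graph (hgraph ▸ AnalyticSet.image_of_continuous ?_ (by fun_prop))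
  exact analyticSet_inter (hR.preimage continuous_snd) hS

theorem eqStar_setOf_eq_true_iff {x y : ℕ → Bool} :
    eqStar {n | x n = true} {n | y n = true} ↔ x =ᶠ[cofinite] y := by
  refine iff_of_eq (congrArg Set.Finite ?_)
  ext n
  change _ ↔ ¬ x n = y n
  rw [Set.mem_symmDiff, Set.mem_ofPred_eq, Set.mem_ofPred_eq]
  cases x n <;> cases y n <;> decide

theorem not_forall_eq_iff_eqStar_of_analyticSet_subset {X : Type*} [TopologicalSpace X]
    [PolishSpace X] {LE R : Set (Fin 2 → X)} (hLE : AnalyticSet LE) (hR : AnalyticSet R)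
    {c d : Set ℕ → X} (hc : ∀ A B, ![c A, c B] ∈ LE ↔ A ⊆ B)
    (hcd : R = Set.range fun A => ![c A, d A]) : ¬ ∀ A B, d A = d B ↔ eqStar A B := by
  let : MeasurableSpace X := borel X
  have : BorelSpace X := ⟨rfl⟩
  intro hd
  exact not_forall_eq_iff_eventuallyEq_cofinite (measurable_of_analyticSet_subset hLE hR hc hcd)
    fun x y => (hd _ _).trans eqStar_setOf_eq_true_iff

theorem relSet_eq_image_equiv {L : Language} {M X : Type} [L.Structure M] {D : Set X}
    [L.Structure D] (φ : M ≃[L] D) {n : ℕ} (r : L.Relations n) :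
    relSet L D r = ((fun a => (φ a : X)) ∘ ·) '' {y | Language.Structure.RelMap r y} := by
  have : {y : Fin n → D | Language.Structure.RelMap r y} =
      (φ ∘ ·) '' {y | Language.Structure.RelMap r y} := by
    ext y
    obtain ⟨y, rfl⟩ := φ.surjective.comp_left y
    rw [φ.injective.comp_left.mem_set_image]
    exact φ.map_rel r y
  rw [relSet, this, Set.image_image]
  rfl

namespace PowersetAndQuotient

/-- A set of natural numbers, as an element of the first summand. -/
def ofSet (A : Set ℕ) : PowersetAndQuotient := Sum.inl A

/-- The class of a set of natural numbers modulo `=^*`, as an element of the second summand. -/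
def ofClass (A : Set ℕ) : PowersetAndQuotient := Sum.inr (Quotient.mk eqStar A)

theorem ofClass_eq_iff {A B : Set ℕ} : ofClass A = ofClass B ↔ eqStar A B :=
  Sum.inr_injective.eq_iff.trans Quotient.eq

theorem setOf_relMap_R_eq_range :
    {y : Fin 2 → PowersetAndQuotient |
      Language.Structure.RelMap (L := witnessLang) WitnessRel.R y} =
      Set.range fun A => ![ofSet A, ofClass A] := by
  ext y
  refine exists_congr fun A => ?_
  rw [funext_iff, Fin.forall_fin_two]
  exact and_congr eq_comm eq_comm

theorem not_isAnalyticPresentable : ¬ IsAnalyticPresentable witnessLang PowersetAndQuotient := by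
  rintro ⟨X, _, _, D, _, -, hrel, ⟨φ⟩⟩
  let f : PowersetAndQuotient → X := fun a => φ a
  have hf : Function.Injective f := Subtype.val_injective.comp φ.injective
  have hf₂ : Function.Injective ((f ∘ ·) : (Fin 2 → PowersetAndQuotient) → Fin 2 → X) :=
    hf.comp_left
  have hvec (a b : PowersetAndQuotient) : f ∘ ![a, b] = ![f a, f b] :=
    funext (Fin.forall_fin_two.2 ⟨rfl, rfl⟩)
  let leSymbol : witnessLang.Relations 2 := WitnessRel.le
  let projSymbol : witnessLang.Relations 2 := WitnessRel.R
  refine not_forall_eq_iff_eqStar_of_analyticSet_subset (hrel leSymbol) (hrel projSymbol)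
    (c := f ∘ ofSet) (d := f ∘ ofClass) (fun A B => ?_) ?_ fun A B => hf.eq_iff.trans ofClass_eq_iff
  · rw [relSet_eq_image_equiv φ, Function.comp_apply, Function.comp_apply, ← hvec,
      hf₂.mem_set_image]
    exact Sum.liftRel_inl_inl
  · rw [relSet_eq_image_equiv φ, setOf_relMap_R_eq_range, ← Set.range_comp]
    exact congrArg Set.range (funext fun A => hvec _ _)

end PowersetAndQuotient

/-! ### Recognizable relations on sets of natural numbers -/

namespace BuchiAutomaton

variable {α : Type} {σ : α → Type} (M : ∀ a, BuchiAutomaton α (σ a))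

/-- The automaton that uses the first letter `a` of its input to select the automaton `M a`, which
then runs on the rest of the input. -/
def afterHead : BuchiAutomaton α (Option (Σ a, σ a)) where
  init := none
  trans := {t | match t with
    | (none, a, q) => q = some ⟨a, (M a).init⟩
    | (some ⟨a, p⟩, b, q) => ∃ p', (p, b, p') ∈ (M a).trans ∧ q = some ⟨a, p'⟩}
  accept := {q | ∃ a, ∃ s ∈ (M a).accept, q = some ⟨a, s⟩}

variable {M}

theorem isRun_afterHead_iff {w : ℕ → α} {q : ℕ → Option (Σ a, σ a)} :
    (afterHead M).IsRun w q ↔ q 0 = none ∧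
      ∃ p, (M (w 0)).IsRun (fun n => w (n + 1)) p ∧ ∀ i, q (i + 1) = some ⟨w 0, p i⟩ := by
  constructor
  · rintro ⟨h0, hq⟩
    have hstep : ∀ i p, q (i + 1) = some ⟨w 0, p⟩ →
        ∃ p', (p, w (i + 1), p') ∈ (M (w 0)).trans ∧ q (i + 2) = some ⟨w 0, p'⟩ := fun i p hp => by
      have := hq (i + 1)
      rw [hp] at this
      exact this
    have h1 : q 1 = some ⟨w 0, (M (w 0)).init⟩ := by
      have := hq 0
      rw [h0] at this
      exact this
    have hex : ∀ i, ∃ p, q (i + 1) = some ⟨w 0, p⟩ := fun i => by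
      induction i with
      | zero => exact ⟨_, h1⟩
      | succ i ih =>
        obtain ⟨p, hp⟩ := ih
        obtain ⟨p', -, hp'⟩ := hstep i p hp
        exact ⟨p', hp'⟩
    choose p hp using hex
    refine ⟨h0, p, ⟨?_, fun i => ?_⟩, hp⟩
    · simpa using (hp 0).symm.trans h1
    · obtain ⟨p', hp', hq'⟩ := hstep i (p i) (hp i)
      obtain rfl : p (i + 1) = p' := by simpa using (hp (i + 1)).symm.trans hq'
      exact hp'
  · rintro ⟨h0, p, ⟨hp0, hp⟩, hq⟩
    refine ⟨h0, fun i => ?_⟩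
    cases i with
    | zero => rw [h0, hq 0, hp0]; rfl
    | succ i => rw [hq i, hq (i + 1)]; exact ⟨_, hp i, rfl⟩

theorem acceptedSet_afterHead :
    (afterHead M).acceptedSet = {w | (fun n => w (n + 1)) ∈ (M (w 0)).acceptedSet} := by
  ext w
  constructor
  · rintro ⟨q, hq, _, ⟨a, s, hs, rfl⟩, hfreq⟩
    obtain ⟨-, p, hp, hqp⟩ := isRun_afterHead_iff.1 hq
    rw [← map_add_atTop_eq_nat 1, frequently_map] at hfreq
    simp only [hqp, Option.some.injEq] at hfreq
    obtain ⟨i, hi⟩ := hfreq.exists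
    obtain ⟨rfl, -⟩ := Sigma.mk.inj_iff.1 hi
    refine ⟨p, hp, s, hs, ?_⟩
    simpa using hfreq
  · rintro ⟨p, hp, s, hs, hfreq⟩
    refine ⟨fun i => i.casesOn none fun i => some ⟨w 0, p i⟩,
      isRun_afterHead_iff.2 ⟨rfl, p, hp, fun _ => rfl⟩, _, ⟨w 0, s, hs, rfl⟩, ?_⟩
    rw [← map_add_atTop_eq_nat 1, frequently_map]
    simpa using hfreq

end BuchiAutomaton

theorem IsBuchiRecognizable.afterHead {α : Type} [Finite α] {W : α → Set (ℕ → α)}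
    (h : ∀ a, IsBuchiRecognizable (W a)) :
    IsBuchiRecognizable {w | (fun n => w (n + 1)) ∈ W (w 0)} := by
  choose σ _ M hM using h
  refine ⟨_, inferInstance, BuchiAutomaton.afterHead M, ?_⟩
  simp only [BuchiAutomaton.acceptedSet_afterHead, hM]

theorem isBuchiRecognizable_setOf_forall {α : Type} (P : α → Prop) :
    IsBuchiRecognizable {w | ∀ n, P (w n)} := by
  refine ⟨Unit, inferInstance, ⟨(), {t | P t.2.1}, Set.univ⟩, ?_⟩
  ext w
  exact ⟨fun ⟨_, hq, _⟩ => hq.2,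
    fun h => ⟨fun _ => (), ⟨rfl, h⟩, (), trivial, .of_forall fun _ => rfl⟩⟩

theorem isBuchiRecognizable_setOf_eventually {α : Type} (P : α → Prop) :
    IsBuchiRecognizable {w | ∀ᶠ n in atTop, P (w n)} := by
  classical
  refine ⟨Bool, inferInstance, ⟨false, {t | t.1 = true → P t.2.1 ∧ t.2.2 = true}, {true}⟩, ?_⟩
  ext w
  constructor
  · rintro ⟨q, ⟨-, hq⟩, _, rfl, hfreq⟩
    obtain ⟨N, hN⟩ := hfreq.exists
    have hstay : ∀ n ≥ N, q n = true := fun n hn =>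
      Nat.le_induction hN (fun n _ ih => (hq n ih).2) n hn
    filter_upwards [eventually_ge_atTop N] with n hn using (hq n (hstay n hn)).1
  · intro h
    obtain ⟨N, hN⟩ := eventually_atTop.1 h
    refine ⟨fun n => decide (N < n), ⟨by simp, fun n hn => ?_⟩, true, rfl, ?_⟩
    · simp only [decide_eq_true_eq] at hn ⊢
      exact ⟨hN n hn.le, hn.trans n.lt_succ_self⟩
    · refine Eventually.frequently ?_
      filter_upwards [eventually_gt_atTop N] with n hn using decide_eq_true hn

/-- The element of the disjoint union of two copies of the power set that a bit sequence codes: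
the first bit selects the copy, `true` for the first one, and the remaining bits are the
characteristic sequence of the set. -/
def decode (w : ℕ → Bool) : Set ℕ ⊕ Set ℕ :=
  cond (w 0) Sum.inl Sum.inr {n | w (n + 1) = true}

theorem decode_injective : Function.Injective decode := by
  intro v w h
  have : v 0 = w 0 ∧ {n | v (n + 1) = true} = {n | w (n + 1) = true} := by
    unfold decode at h
    cases hv : v 0 <;> cases hw : w 0 <;> simp_all
  funext n
  cases n with
  | zero => exact this.1
  | succ n => exact Bool.eq_iff_iff.2 (Set.ext_iff.1 this.2 n)

theorem decode_surjective : Function.Surjective decode := by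
  classical
  rintro (A | A)
  · exact ⟨fun n => n.casesOn true fun n => decide (n ∈ A), by simp [decode]⟩
  · exact ⟨fun n => n.casesOn false fun n => decide (n ∈ A), by simp [decode]⟩

theorem isBuchiRecognizableRel_iff {α : Type} {k : ℕ} {R : Set (Fin k → ℕ → α)} :
    IsBuchiRecognizableRel R ↔
      IsBuchiRecognizable {w : ℕ → Fin k → α | (fun j n => w n j) ∈ R} := by
  refine iff_of_eq (congrArg IsBuchiRecognizable ?_)
  ext w
  exact ⟨by rintro ⟨x, hx, rfl⟩; exact hx, fun h => ⟨_, h, rfl⟩⟩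

theorem isBuchiRecognizableRel_setOf_decode_comp_mem {k : ℕ} {T : Set (Fin k → Set ℕ ⊕ Set ℕ)}
    (h : ∀ a : Fin k → Bool, IsBuchiRecognizable {w : ℕ → Fin k → Bool |
      (fun j => cond (a j) Sum.inl Sum.inr {n | w n j = true}) ∈ T}) :
    IsBuchiRecognizableRel {x | decode ∘ x ∈ T} :=
  isBuchiRecognizableRel_iff.2 (.afterHead h)

theorem isBuchiRecognizable_empty {α : Type} : IsBuchiRecognizable (∅ : Set (ℕ → α)) := by
  simpa using isBuchiRecognizable_setOf_forall fun _ : α => False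

theorem isBuchiRecognizable_univ {α : Type} : IsBuchiRecognizable (Set.univ : Set (ℕ → α)) := by
  simpa using isBuchiRecognizable_setOf_forall fun _ : α => True

/-- A binary relation on sets of natural numbers, read as a set of infinite strings over `Bool²`,
is Büchi recognizable. -/
def IsRecognizableSetRel (P : Set ℕ → Set ℕ → Prop) : Prop :=
  IsBuchiRecognizable {w : ℕ → Fin 2 → Bool | P {n | w n 0 = true} {n | w n 1 = true}}

section SetRel

variable {P Q : Set ℕ → Set ℕ → Prop}

theorem isRecognizableSetRel_of_forall (p : Prop → Prop → Prop)
    (h : ∀ A B, P A B ↔ ∀ n, p (n ∈ A) (n ∈ B)) : IsRecognizableSetRel P := by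
  simp only [IsRecognizableSetRel, h]
  exact isBuchiRecognizable_setOf_forall fun a : Fin 2 → Bool => p (a 0 = true) (a 1 = true)

theorem isRecognizableSetRel_of_eventually (p : Prop → Prop → Prop)
    (h : ∀ A B, P A B ↔ ∀ᶠ n in cofinite, p (n ∈ A) (n ∈ B)) : IsRecognizableSetRel P := by
  simp only [IsRecognizableSetRel, h, Nat.cofinite_eq_atTop]
  exact isBuchiRecognizable_setOf_eventually fun a : Fin 2 → Bool => p (a 0 = true) (a 1 = true)

theorem isRecognizableSetRel_subset : IsRecognizableSetRel (· ⊆ ·) :=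
  isRecognizableSetRel_of_forall (· → ·) fun _ _ => Iff.rfl

theorem isRecognizableSetRel_eq : IsRecognizableSetRel (· = ·) :=
  isRecognizableSetRel_of_forall (· ↔ ·) fun _ _ => Set.ext_iff

theorem isRecognizableSetRel_finite_sdiff :
    IsRecognizableSetRel fun A B => (A \ B).Finite :=
  isRecognizableSetRel_of_eventually (· → ·) fun A B => by
    rw [eventually_cofinite]
    simp only [Classical.not_imp]
    rfl

theorem isRecognizableSetRel_eqStar : IsRecognizableSetRel eqStar :=
  isRecognizableSetRel_of_eventually (· ↔ ·) fun A B => by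
    rw [eventually_cofinite]
    refine iff_of_eq (congrArg Set.Finite ?_)
    ext n
    change _ ↔ ¬ (n ∈ A ↔ n ∈ B)
    rw [Set.mem_symmDiff]
    tauto

theorem IsRecognizableSetRel.liftRel (hP : IsRecognizableSetRel P)
    (hQ : IsRecognizableSetRel Q) :
    IsBuchiRecognizableRel {x : Fin 2 → ℕ → Bool |
      Sum.LiftRel P Q (decode (x 0)) (decode (x 1))} := by
  refine isBuchiRecognizableRel_setOf_decode_comp_mem
    (T := {y : Fin 2 → Set ℕ ⊕ Set ℕ | Sum.LiftRel P Q (y 0) (y 1)}) fun a => ?_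
  simp only [Set.mem_ofPred_eq]
  cases a 0 <;> cases a 1
  · simpa [IsRecognizableSetRel] using hQ
  · simpa using isBuchiRecognizable_empty
  · simpa using isBuchiRecognizable_empty
  · simpa [IsRecognizableSetRel] using hP

theorem IsRecognizableSetRel.inl_inr (hP : IsRecognizableSetRel P) :
    IsBuchiRecognizableRel {x : Fin 2 → ℕ → Bool |
      ∃ A B, P A B ∧ decode (x 0) = Sum.inl A ∧ decode (x 1) = Sum.inr B} := by
  refine isBuchiRecognizableRel_setOf_decode_comp_mem
    (T := {y : Fin 2 → Set ℕ ⊕ Set ℕ | ∃ A B, P A B ∧ y 0 = Sum.inl A ∧ y 1 = Sum.inr B})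
    fun a => ?_
  simp only [Set.mem_ofPred_eq]
  cases a 0 <;> cases a 1
  · simpa using isBuchiRecognizable_empty
  · simpa using isBuchiRecognizable_empty
  · simpa [IsRecognizableSetRel] using hP
  · simpa using isBuchiRecognizable_empty

end SetRel

theorem isBuchiRecognizableRel_inl :
    IsBuchiRecognizableRel {x : Fin 1 → ℕ → Bool | ∃ A, decode (x 0) = Sum.inl A} := by
  refine isBuchiRecognizableRel_setOf_decode_comp_mem
    (T := {y : Fin 1 → Set ℕ ⊕ Set ℕ | ∃ A, y 0 = Sum.inl A}) fun a => ?_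
  simp only [Set.mem_ofPred_eq]
  cases a 0
  · simpa using isBuchiRecognizable_empty
  · simpa using isBuchiRecognizable_univ

/-! ### Pulled back structures and their quotients -/

/-- The structure on `M` pulled back along `f : M → N`: a basic relation holds of a tuple of
elements of `M` if it holds of its image under `f`. -/
@[reducible]
def comapStructure (L : Language) [L.IsRelational] {M N : Type} [L.Structure N] (f : M → N) :
    L.Structure M where
  funMap F _ := isEmptyElim F
  RelMap r x := Language.Structure.RelMap r (f ∘ x)

section Comap

variable {L : Language} [L.IsRelational] {M N P : Type} [L.Structure N] [L.Structure P]

/-- A bijection is an isomorphism from the structure pulled back along it. -/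
noncomputable def comapEquiv (f : M → N) (hf : Function.Bijective f) :
    letI := comapStructure L f
    M ≃[L] N :=
  letI := comapStructure L f
  ⟨Equiv.ofBijective f hf, fun F => isEmptyElim F, fun _ _ => Iff.rfl⟩

theorem isCongruence_ker_comapStructure (f : M → N) :
    letI := comapStructure L f
    IsCongruence L (Setoid.ker f) := by
  intro n r x y h
  have hxy : f ∘ x = f ∘ y := funext h
  exact iff_of_eq (congrArg (Language.Structure.RelMap (M := N) r) hxy)

theorem nonempty_quotient_ker_comp_equiv {f : M → N} (hf : Function.Surjective f) {g : N → P}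
    (hg : Function.Surjective g)
    (hrel : ∀ {n : ℕ} (r : L.Relations n) (x : Fin n → P), Language.Structure.RelMap r x ↔
      ∃ y, g ∘ y = x ∧ Language.Structure.RelMap r y) :
    letI := comapStructure L f
    Nonempty (QuotientStructure L (Setoid.ker (g ∘ f)) ≃[L] P) := by
  let := comapStructure L f
  let e := Setoid.quotientKerEquivOfSurjective (g ∘ f) (hg.comp hf)
  refine ⟨⟨e, fun F => isEmptyElim F, fun r x => (hrel r _).trans (hf.comp_left.exists.trans ?_)⟩⟩
  exact exists_congr fun y => and_congr_left' <| funext_iff.trans <|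
    forall_congr' fun i => e.injective.eq_iff (a := Quotient.mk _ (y i))

theorem isBuchiAutomatic_comapStructure {α : Type} [Nonempty α] {f : (ℕ → α) → N}
    (h : ∀ {n : ℕ} (r : L.Relations n),
      IsBuchiRecognizableRel {x | Language.Structure.RelMap r (f ∘ x)}) :
    letI := comapStructure L fun w : (Set.univ : Set (ℕ → α)) => f w
    IsBuchiAutomatic L (Set.univ : Set (ℕ → α)) := by
  let := comapStructure L fun w : (Set.univ : Set (ℕ → α)) => f w
  refine ⟨Set.univ_nonempty, isBuchiRecognizable_univ, fun {n} r => ?_⟩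
  have : relSet L Set.univ r = {x | Language.Structure.RelMap r (f ∘ x)} :=
    Set.ext fun x =>
      ⟨by rintro ⟨y, hy, rfl⟩; exact hy, fun hx => ⟨fun i => ⟨x i, trivial⟩, hx, rfl⟩⟩
  exact this ▸ h r

end Comap

theorem pairSet_univ_eq {X : Type} (E : X → X → Prop) :
    pairSet Set.univ (fun a b => E a b) = {x | E (x 0) (x 1)} := by
  ext x
  constructor
  · rintro ⟨a, b, h, rfl⟩
    exact h
  · exact fun h => ⟨⟨x 0, trivial⟩, ⟨x 1, trivial⟩, h, funext (Fin.forall_fin_two.2 ⟨rfl, rfl⟩)⟩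

/-- The identity on the first copy and the projection modulo `=^*` on the second one. -/
def collapse : Set ℕ ⊕ Set ℕ → PowersetAndQuotient := Sum.map id (Quotient.mk eqStar)

theorem collapse_surjective : Function.Surjective collapse :=
  Sum.map_surjective.2 ⟨Function.surjective_id, Quotient.mk_surjective⟩

theorem collapse_eq_iff {a b : Set ℕ ⊕ Set ℕ} :
    collapse a = collapse b ↔ Sum.LiftRel (· = ·) eqStar a b := by
  rcases a with A | A <;> rcases b with B | B
  · exact Sum.inl_injective.eq_iff.trans Sum.liftRel_inl_inl.symm
  · exact iff_of_false Sum.inl_ne_inr Sum.not_liftRel_inl_inr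
  · exact iff_of_false Sum.inr_ne_inl Sum.not_liftRel_inr_inl
  · exact Sum.inr_injective.eq_iff.trans (Quotient.eq.trans Sum.liftRel_inr_inr.symm)

theorem collapse_eq_inl_iff {a : Set ℕ ⊕ Set ℕ} {A : Set ℕ} :
    collapse a = Sum.inl A ↔ a = Sum.inl A := by
  refine (collapse_eq_iff (b := Sum.inl A)).trans ?_
  rcases a with B | B <;> simp

theorem collapse_eq_inr_mk_iff {a : Set ℕ ⊕ Set ℕ} {A : Set ℕ} :
    collapse a = Sum.inr (Quotient.mk eqStar A) ↔ ∃ B, eqStar A B ∧ a = Sum.inr B := by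
  refine eq_comm.trans ((collapse_eq_iff (a := Sum.inr A)).trans ?_)
  rcases a with B | B <;> simp

theorem liftRel_collapse_iff {a b : Set ℕ ⊕ Set ℕ} :
    Sum.LiftRel (· ⊆ ·) leStar (collapse a) (collapse b) ↔
      Sum.LiftRel (· ⊆ ·) (fun A B => (A \ B).Finite) a b := by
  rcases a with A | A <;> rcases b with B | B
  · exact Sum.liftRel_inl_inl.trans Sum.liftRel_inl_inl.symm
  · exact iff_of_false Sum.not_liftRel_inl_inr Sum.not_liftRel_inl_inr
  · exact iff_of_false Sum.not_liftRel_inr_inl Sum.not_liftRel_inr_inl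
  · rw [Sum.liftRel_inr_inr]
    exact Sum.liftRel_inr_inr

theorem eqStar_inter_of_finite_sdiff {A B : Set ℕ} (h : (A \ B).Finite) : eqStar (A ∩ B) A := by
  refine h.subset fun n hn => ?_
  simp only [Set.mem_symmDiff, Set.mem_inter_iff, Set.mem_sdiff] at hn ⊢
  tauto

theorem exists_collapse_eq_and_liftRel_subset {a b : Set ℕ ⊕ Set ℕ}
    (h : Sum.LiftRel (· ⊆ ·) (fun A B => (A \ B).Finite) a b) :
    ∃ a', collapse a' = collapse a ∧ Sum.LiftRel (· ⊆ ·) (· ⊆ ·) a' b := by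
  rcases h with h | h
  · exact ⟨_, rfl, .inl h⟩
  · exact ⟨_, collapse_eq_iff.2 (.inr (eqStar_inter_of_finite_sdiff h)),
      .inr Set.inter_subset_right⟩

theorem relMap_collapse_comp {n : ℕ} (r : witnessLang.Relations n) {y : Fin n → TwoCopies}
    (h : Language.Structure.RelMap r y) : Language.Structure.RelMap r (collapse ∘ y) := by
  rcases r with _ | _ | _
  · refine liftRel_collapse_iff.2 (Sum.LiftRel.mono (fun _ _ => id) (fun A B hAB => ?_) h)
    rw [Set.sdiff_eq_empty.2 hAB]
    exact Set.finite_empty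
  · exact h.imp fun A => congrArg collapse
  · exact h.imp fun A => And.imp (congrArg collapse) (congrArg collapse)

theorem relMap_iff_exists_collapse_comp {n : ℕ} (r : witnessLang.Relations n)
    (x : Fin n → PowersetAndQuotient) : Language.Structure.RelMap r x ↔
      ∃ y : Fin n → TwoCopies, collapse ∘ y = x ∧ Language.Structure.RelMap r y := by
  refine ⟨fun h => ?_, by rintro ⟨y, rfl, hy⟩; exact relMap_collapse_comp r hy⟩
  obtain ⟨a, rfl⟩ := collapse_surjective.comp_left x
  rcases r with _ | _ | _
  · obtain ⟨a', ha', hle⟩ := exists_collapse_eq_and_liftRel_subset (liftRel_collapse_iff.1 h)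
    exact ⟨![a', a 1], funext (Fin.forall_fin_two.2 ⟨ha', rfl⟩), hle⟩
  · exact ⟨a, rfl, h.imp fun A => collapse_eq_inl_iff.1⟩
  · obtain ⟨A, h0, h1⟩ := h
    exact ⟨![Sum.inl A, Sum.inr A], funext (Fin.forall_fin_two.2 ⟨h0.symm, h1.symm⟩), A, rfl, rfl⟩

theorem isBuchiRecognizableRel_relMap_decode {n : ℕ} (r : witnessLang.Relations n) :
    IsBuchiRecognizableRel {x : Fin n → ℕ → Bool |
      Language.Structure.RelMap (M := TwoCopies) r (decode ∘ x)} := by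
  rcases r with _ | _ | _
  · exact isRecognizableSetRel_subset.liftRel isRecognizableSetRel_subset
  · exact isBuchiRecognizableRel_inl
  · convert isRecognizableSetRel_eq.inl_inr using 2
    ext x
    exact exists_congr fun A => (exists_eq_left'
      (p := fun B => decode (x 0) = Sum.inl A ∧ decode (x 1) = Sum.inr B)).symm

theorem isBuchiRecognizableRel_relMap_collapse_decode {n : ℕ} (r : witnessLang.Relations n) :
    IsBuchiRecognizableRel {x : Fin n → ℕ → Bool |
      Language.Structure.RelMap r ((collapse ∘ decode) ∘ x)} := by
  rcases r with _ | _ | _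
  · convert isRecognizableSetRel_subset.liftRel isRecognizableSetRel_finite_sdiff using 2
    ext x
    exact liftRel_collapse_iff
  · convert isBuchiRecognizableRel_inl using 2
    ext x
    exact exists_congr fun A => collapse_eq_inl_iff
  · convert isRecognizableSetRel_eqStar.inl_inr using 2
    ext x
    refine exists_congr fun A => (and_congr collapse_eq_inl_iff collapse_eq_inr_mk_iff).trans ?_
    rw [← exists_and_left]
    exact exists_congr fun B => and_left_comm

theorem isBuchiRecognizableRel_pairSet_ker :
    IsBuchiRecognizableRel (pairSet Set.univ fun a b : (Set.univ : Set (ℕ → Bool)) =>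
      Setoid.ker (fun w : (Set.univ : Set (ℕ → Bool)) => collapse (decode w)) a b) := by
  convert isRecognizableSetRel_eq.liftRel isRecognizableSetRel_eqStar using 1
  refine (pairSet_univ_eq fun v w => collapse (decode v) = collapse (decode w)).trans ?_
  exact Set.ext fun x => collapse_eq_iff

theorem not_isBuchiPresentable_and_not_isBorelPresentable {M : Type} [witnessLang.Structure M]
    (h : Nonempty (M ≃[witnessLang] PowersetAndQuotient)) :
    ¬ IsBuchiPresentable witnessLang M ∧ ¬ IsBorelPresentable witnessLang M := by
  obtain ⟨e⟩ := h
  exact ⟨fun h => PowersetAndQuotient.not_isAnalyticPresentable (h.isAnalyticPresentable.congr e),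
    fun h => PowersetAndQuotient.not_isAnalyticPresentable (h.isAnalyticPresentable.congr e)⟩

end

theorem mainTheorem6 :
    -- two copies of the power set, with `=^*` on the second copy
    (∃ (α : Type) (_ : Finite α) (D : Set (ℕ → α)) (_ : witnessLang.Structure D) (E : Setoid D),
      IsBuchiAutomatic witnessLang D ∧
      IsBuchiRecognizableRel (pairSet D (fun a b => E a b)) ∧
      (∃ e : D ≃[witnessLang] TwoCopies, ∀ a b : D, E a b ↔ twoCopiesRel (e a) (e b)) ∧
      Nonempty (QuotientStructure witnessLang E ≃[witnessLang] PowersetAndQuotient) ∧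
      ¬ IsBuchiPresentable witnessLang (QuotientStructure witnessLang E) ∧
      ¬ IsBorelPresentable witnessLang (QuotientStructure witnessLang E)) ∧
    -- the same quotient, by an equivalence relation that respects all basic relations
    (∃ (α : Type) (_ : Finite α) (D : Set (ℕ → α)) (_ : witnessLang.Structure D) (E : Setoid D),
      IsBuchiAutomatic witnessLang D ∧
      IsBuchiRecognizableRel (pairSet D (fun a b => E a b)) ∧
      IsCongruence witnessLang E ∧
      Nonempty (QuotientStructure witnessLang E ≃[witnessLang] PowersetAndQuotient) ∧
      ¬ IsBuchiPresentable witnessLang (QuotientStructure witnessLang E) ∧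
      ¬ IsBorelPresentable witnessLang (QuotientStructure witnessLang E)) := by
  let decodeUniv : ↥(Set.univ : Set (ℕ → Bool)) → TwoCopies := fun w => decode w
  have hbij : Function.Bijective decodeUniv :=
    ⟨decode_injective.comp Subtype.val_injective,
      decode_surjective.comp fun w => ⟨⟨w, trivial⟩, rfl⟩⟩
  let E : Setoid (Set.univ : Set (ℕ → Bool)) := Setoid.ker (collapse ∘ decodeUniv)
  constructor
  · let := comapStructure witnessLang decodeUniv
    have hquot : Nonempty (QuotientStructure witnessLang E ≃[witnessLang] PowersetAndQuotient) :=
      nonempty_quotient_ker_comp_equiv hbij.surjective collapse_surjective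
        relMap_iff_exists_collapse_comp
    exact ⟨Bool, inferInstance, Set.univ, _, E,
      isBuchiAutomatic_comapStructure isBuchiRecognizableRel_relMap_decode,
      isBuchiRecognizableRel_pairSet_ker,
      ⟨comapEquiv decodeUniv hbij, fun _ _ => collapse_eq_iff⟩,
      hquot, not_isBuchiPresentable_and_not_isBorelPresentable hquot⟩
  · let := comapStructure witnessLang (collapse ∘ decodeUniv)
    have hquot : Nonempty (QuotientStructure witnessLang E ≃[witnessLang] PowersetAndQuotient) :=
      nonempty_quotient_ker_comp_equiv (collapse_surjective.comp hbij.surjective)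
        Function.surjective_id fun r x => (exists_eq_left (p := Language.Structure.RelMap r)).symm
    exact ⟨Bool, inferInstance, Set.univ, _, E,
      isBuchiAutomatic_comapStructure isBuchiRecognizableRel_relMap_collapse_decode,
      isBuchiRecognizableRel_pairSet_ker, isCongruence_ker_comapStructure _,
      hquot, not_isBuchiPresentable_and_not_isBorelPresentable hquot⟩
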